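/- **Model.** A project is a pair $a=(F,c)$, where $F$ is a probability distribution on $\mathbb{R}_+$ with finite expectation (the law of its prize) and $c\ge 0$ is the cost of sampling it. A contract is a measurable function $w:\mathbb{R}_+\to\mathbb{R}_+$. Given a finite collection of projects $\mathcal{A}=\{a_0,\dots,a_n\}$ with independent prizes $y_i\sim F_i$, an agent searches sequentially with recall: a strategy $\sigma$ decides, as a (measurable) function of the set of projects sampled so far and the highest wage currently available, which unsampled project to sample next or to stop; on stopping the agent presents an available prize $y$ with the highest wage (the prize $0$ is always available). The agent's payoff is $w(y)-\sum_i c_i\mathbf{1}[a_i\text{ sampled}]$ and the principal's payoff is $y-w(y)$. Let $\Sigma(w,\mathcal{A})$ be the set of strategies maximizing the agent's expected payoff, let $$V_P(w\mid\mathcal{A})=\sup_{\sigma\in\Sigma(w,\mathcal{A})}\mathbb{E}_\sigma[y-w(y)],$$ where the agent breaks all ties (also those between prizes with equal wage) in favor of the principal, and, for a known project $a_0=(F_0,c_0)$ and $\mathcal{A}_0=\{a_0\}$, let $$V_P(w)=\inf_{\mathcal{A}\supseteq\mathcal{A}_0}V_P(w\mid\mathcal{A}),$$ the infimum being over all finite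 collections of projects that contain $a_0$. The $w$-induced index $r_0^w\in(-\infty,\infty]$ of $a_0$ is the smallest solution $r$ of $c_0=\int [w(y)-r]^+\,dF_0(y)$ (with $r_0^w=\infty$ if there is no real solution). The contract $w$ is doubly monotone if both $w(y)$ and $y-w(y)$ are non-decreasing in $y$. **Statement.** Let $a_0$ be any known project and $w$ any doubly monotone contract. Then either 1. $V_P(w\mid\mathcal{A}_0)=V_P(w)$, or 2. for every $\epsilon>0$ there is an $x\in\mathbb{R}_+$ with $w(x)>r_0^w$ such that, with $a_1=(\delta_x,0)$ (the project that yields the prize $x$ for certain at cost $0$), $$V_P(w\mid\mathcal{A}_0\cup\{a_1\})<V_P(w)+\epsilon .$$ -/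

import Mathlib

open MeasureTheory
open scoped NNReal

namespace DelegatedSearch

/-- A project (Pandora's box): a prize distribution on `ℝ₊` with finite expectation,
and a nonnegative cost of learning the realized prize. -/
structure Project where
  law : Measure ℝ≥0
  isProb : IsProbabilityMeasure law
  finite_mean : Integrable (fun y : ℝ≥0 => (y : ℝ)) law
  cost : ℝ≥0

/-- The free safe project `(δ_x, 0)`. -/
noncomputable def Project.safe (x : ℝ≥0) : Project where
  law := Measure.dirac x
  isProb := inferInstance
  finite_mean := integrable_dirac (by simp)
  cost := 0

/-- A wage contract: a measurable function of the presented prize satisfying limited liability. -/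
structure Contract where
  wage : ℝ≥0 → ℝ
  measurable_wage : Measurable wage
  limited_liability : ∀ y, 0 ≤ wage y

/-- Both the agent's wage and the principal's profit are non-decreasing in the prize. -/
def Contract.DoublyMonotone (w : Contract) : Prop :=
  Monotone w.wage ∧ Monotone (fun y : ℝ≥0 => (y : ℝ) - w.wage y)

/-- The prizes the agent can present after opening the boxes in `S`, when box `i` contains `y i`:
the prizes found, and the prize zero, which is always available. -/
noncomputable def availablePrizes {n : ℕ} (y : Fin n → ℝ≥0) (S : Finset (Fin n)) : Finset ℝ≥0 :=
  insert 0 (S.image y)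

/-- The highest wage the agent can collect after opening the boxes in `S`. -/
noncomputable def bestWage (w : Contract) {n : ℕ} (y : Fin n → ℝ≥0) (S : Finset (Fin n)) : ℝ :=
  (availablePrizes y S).sup' (Finset.insert_nonempty _ _) w.wage

open Classical in
/-- The prize presented on stopping: one that yields the best available wage and, among those,
the one the principal likes best. As the wage is the same for all of them, that is the largest. -/
noncomputable def presentedPrize (w : Contract) {n : ℕ} (y : Fin n → ℝ≥0)
    (S : Finset (Fin n)) : ℝ≥0 :=
  ((availablePrizes y S).filter (fun p => w.wage p = bestWage w y S)).sup id

/-- A search strategy over `n` boxes. Given the set of boxes opened so far and the best wage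
currently available, it either opens a new box or stops (`none`). -/
structure Strategy (n : ℕ) where
  next : Finset (Fin n) → ℝ → Option (Fin n)
  not_mem_of_next : ∀ S v i, next S v = some i → i ∉ S
  measurableSet_next : ∀ S i, MeasurableSet {v : ℝ | next S v = some i}

/-- The boxes opened during the first `k` steps when box `i` contains the prize `y i`. -/
noncomputable def Strategy.opened {n : ℕ} (σ : Strategy n) (w : Contract) (y : Fin n → ℝ≥0) :
    ℕ → Finset (Fin n)
  | 0 => ∅
  | k + 1 =>
    match σ.next (σ.opened w y k) (bestWage w y (σ.opened w y k)) with
    | none => σ.opened w y k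
    | some i => insert i (σ.opened w y k)

/-- The boxes opened by the time the search has ended. Each step opens a new box or ends the
search, so with `n` boxes the search is over after `n` steps. -/
noncomputable def Strategy.finalOpened {n : ℕ} (σ : Strategy n) (w : Contract)
    (y : Fin n → ℝ≥0) : Finset (Fin n) :=
  σ.opened w y n

/-- The prize presented at the end of the search. -/
noncomputable def Strategy.finalPrize {n : ℕ} (σ : Strategy n) (w : Contract)
    (y : Fin n → ℝ≥0) : ℝ≥0 :=
  presentedPrize w y (σ.finalOpened w y)

/-- The joint law of the prizes, which are drawn independently across projects. -/
noncomputable def prizeLaw {n : ℕ} (A : Fin n → Project) : Measure (Fin n → ℝ≥0) :=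
  Measure.pi (fun i => (A i).law)

/-- The agent's expected payoff: wage minus the costs of the boxes opened. -/
noncomputable def agentValue (w : Contract) {n : ℕ} (A : Fin n → Project) (σ : Strategy n) : ℝ :=
  ∫ y, (w.wage (σ.finalPrize w y) - ∑ i ∈ σ.finalOpened w y, ((A i).cost : ℝ)) ∂prizeLaw A

/-- The principal's expected payoff under a given strategy of the agent. -/
noncomputable def principalValue (w : Contract) {n : ℕ} (A : Fin n → Project)
    (σ : Strategy n) : ℝ :=
  ∫ y, ((σ.finalPrize w y : ℝ) - w.wage (σ.finalPrize w y)) ∂prizeLaw A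

/-- The agent's optimal search strategies. -/
def optimalStrategies (w : Contract) {n : ℕ} (A : Fin n → Project) : Set (Strategy n) :=
  {σ | ∀ τ : Strategy n, agentValue w A τ ≤ agentValue w A σ}

/-- The principal's payoff `V_P(w ∣ A)`; the agent breaks ties in favor of the principal. -/
noncomputable def principalPayoff (w : Contract) {n : ℕ} (A : Fin n → Project) : EReal :=
  ⨆ σ ∈ optimalStrategies w A, ((principalValue w A σ : ℝ) : EReal)

/-- The payoff guarantee `V_P(w)`: the infimum of `V_P(w ∣ A)` over all finite collections
`A = (a₀, a₁, …, aₙ)` that contain the known project `a₀`. -/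
noncomputable def payoffGuarantee (w : Contract) (a₀ : Project) : EReal :=
  ⨅ (n : ℕ) (A : Fin (n + 1) → Project) (_ : A 0 = a₀), principalPayoff w A

/-- The `w`-induced index of a project `(F, c)`: the smallest solution `r` of
`c = ∫ [w(y) - r]⁺ dF(y)`. It is `⊤` when there is no real solution, which can happen only if
`c = 0` and the wage is essentially unbounded. -/
noncomputable def inducedIndex (w : Contract) (a : Project) : EReal :=
  sInf ((fun r : ℝ => (r : EReal)) ''
    {r : ℝ | (a.cost : ℝ) = ∫ y, max (w.wage y - r) 0 ∂a.law})

end DelegatedSearch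

namespace DelegatedSearch

/-! Take an optimal strategy that keeps searching whenever it is indifferent. If it opens the known
box, the presented prize is at least the prize in that box. If it leaves the box closed, the wage in
hand exceeds the index. Opening a box is independent of its content, so, profit being monotone, the
principal gets at least q E + (1 - q) m. Here E is the expected profit of the known project, and m
bounds from below the profits of all prizes paid above the index
(`exists_weighted_le_principalPayoff`). So the guarantee is at least min(E, m).

Conversely, the known project alone yields at most E (`principalPayoff_single_le`), and a safe prize
x paid above the index caps the payoff at the profit from x (`principalPayoff_safe_le`). If the
guarantee is below the payoff from the known project alone, it is below E, hence at least the
infimal m, and an x nearly attaining that infimum is the required one.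

Optimal play is described by the Bellman value `searchValue` alone; no optimality theorem for index
policies is needed. -/

theorem measurePreserving_update_pi {ι : Type*} [Fintype ι] [DecidableEq ι] {X : ι → Type*}
    [∀ i, MeasurableSpace (X i)] (μ : ∀ i, Measure (X i)) [∀ i, IsProbabilityMeasure (μ i)]
    (i : ι) :
    MeasurePreserving (fun p : (∀ j, X j) × X i => Function.update p.1 i p.2)
      ((Measure.pi μ).prod (μ i)) (Measure.pi μ) := by
  have hm : Measurable (fun p : (∀ j, X j) × X i => Function.update p.1 i p.2) := by
    refine measurable_pi_lambda _ fun j => ?_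
    by_cases h : j = i
    · subst h
      simpa using measurable_snd
    · simp only [Function.update_of_ne h]
      exact (measurable_pi_apply j).comp measurable_fst
  refine ⟨hm, (Measure.pi_eq fun s hs => ?_).symm⟩
  rw [Measure.map_apply hm (MeasurableSet.univ_pi hs)]
  -- The old `i`-th coordinate is discarded, so its side is unconstrained and the fresh draw carries
  -- the condition.
  have : (fun p : (∀ j, X j) × X i => Function.update p.1 i p.2) ⁻¹' Set.univ.pi s =
      (Set.univ.pi (Function.update s i Set.univ)) ×ˢ s i := by
    ext p
    simp only [Set.mem_preimage, Set.mem_univ_pi, Set.mem_prod]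
    constructor
    · intro h
      refine ⟨fun j => ?_, by simpa using h i⟩
      by_cases hj : j = i
      · subst hj; simp
      · simpa [hj] using h j
    · rintro ⟨h, h'⟩ j
      by_cases hj : j = i
      · subst hj; simpa using h'
      · simpa [hj] using h j
  rw [this, Measure.prod_prod, Measure.pi_pi, ← Finset.prod_erase_mul _ _ (Finset.mem_univ i),
    ← Finset.prod_erase_mul Finset.univ (fun j => μ j (s j)) (Finset.mem_univ i)]
  simp only [Function.update_self, measure_univ, mul_one]
  congr 1
  refine Finset.prod_congr rfl fun j hj => ?_
  rw [Function.update_of_ne (Finset.ne_of_mem_erase hj)]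

/-- A finite random choice among integrable functions is integrable. -/
theorem integrable_finite_choice {Ω κ : Type*} [MeasurableSpace Ω] {μ : Measure Ω} [Fintype κ]
    {T : Ω → κ} (hT : ∀ t, MeasurableSet {y | T y = t}) {f : κ → Ω → ℝ}
    (hf : ∀ t, Integrable (f t) μ) : Integrable (fun y => f (T y) y) μ := by
  classical
  have : (fun y => f (T y) y) = fun y => ∑ t, {y | T y = t}.indicator (f t) y := by
    funext y
    rw [Finset.sum_eq_single (T y)]
    · simp
    · intro t _ ht
      have : y ∉ {y | T y = t} := fun h => ht (Eq.symm h)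
      simp [this]
    · simp
  rw [this]
  exact integrable_finsetSum _ fun t _ => (hf t).indicator (hT t)

instance (a : Project) : IsProbabilityMeasure a.law := a.isProb

instance {n : ℕ} (A : Fin n → Project) : IsProbabilityMeasure (prizeLaw A) := by
  unfold prizeLaw; infer_instance

/-- The principal's profit from a presented prize. -/
noncomputable def Contract.profit (w : Contract) (y : ℝ≥0) : ℝ := y - w.wage y

/-! ### Prizes and wages in hand -/

section Available

variable {w : Contract} {n : ℕ} {y z : Fin n → ℝ≥0} {S : Finset (Fin n)} {i : Fin n}

theorem availablePrizes_insert :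
    availablePrizes y (insert i S) = insert (y i) (availablePrizes y S) := by
  simp [availablePrizes, Finset.image_insert, Finset.insert_comm]

theorem mem_availablePrizes {p : ℝ≥0} :
    p ∈ availablePrizes y S ↔ p = 0 ∨ ∃ i ∈ S, y i = p := by
  simp [availablePrizes]

theorem bestWage_empty : bestWage w y ∅ = w.wage 0 := by
  simp [bestWage, availablePrizes]

theorem bestWage_insert :
    bestWage w y (insert i S) = max (bestWage w y S) (w.wage (y i)) := by
  refine (Finset.sup'_congr _ availablePrizes_insert fun _ _ => rfl).trans ?_
  exact (Finset.sup'_insert (Finset.insert_nonempty _ _) _).trans (max_comm _ _)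

theorem bestWage_congr (h : ∀ j ∈ S, y j = z j) : bestWage w y S = bestWage w z S := by
  have : availablePrizes y S = availablePrizes z S := by
    unfold availablePrizes
    rw [Finset.image_congr h]
  simp only [bestWage, this]

theorem bestWage_update (hi : i ∉ S) (t : ℝ≥0) :
    bestWage w (Function.update y i t) S = bestWage w y S :=
  bestWage_congr fun _ hj => Function.update_of_ne (ne_of_mem_of_not_mem hj hi) _ _

theorem wage_le_bestWage {p : ℝ≥0} (hp : p ∈ availablePrizes y S) :
    w.wage p ≤ bestWage w y S :=
  Finset.le_sup' w.wage hp

theorem presentedPrize_mem : presentedPrize w y S ∈ availablePrizes y S ∧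
    w.wage (presentedPrize w y S) = bestWage w y S := by
  classical
  obtain ⟨p, hp, hpe⟩ := Finset.exists_mem_eq_sup' (Finset.insert_nonempty 0 (S.image y)) w.wage
  have hne : ((availablePrizes y S).filter (fun p => w.wage p = bestWage w y S)).Nonempty :=
    ⟨p, Finset.mem_filter.2 ⟨hp, hpe.symm⟩⟩
  obtain ⟨q, hq, hqe⟩ := Finset.exists_mem_eq_sup _ hne id
  have : presentedPrize w y S = q := by
    rw [presentedPrize, ← id_eq q, ← hqe]
  rw [this]
  exact Finset.mem_filter.1 hq

/-- A larger available prize would pay at least as much, hence tie for the best wage, and ties go to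
the largest prize. -/
theorem le_presentedPrize (hw : w.DoublyMonotone) {p : ℝ≥0} (hp : p ∈ availablePrizes y S) :
    p ≤ presentedPrize w y S := by
  classical
  by_contra! h
  refine h.not_ge ?_
  have h1 : w.wage p = bestWage w y S :=
    le_antisymm (wage_le_bestWage hp) (presentedPrize_mem.2 ▸ hw.1 h.le)
  have : p ≤ ((availablePrizes y S).filter (fun p => w.wage p = bestWage w y S)).sup id :=
    Finset.le_sup (f := id) (Finset.mem_filter.2 ⟨hp, h1⟩)
  unfold presentedPrize
  convert this

theorem presentedPrize_eq_sup (hw : w.DoublyMonotone) : presentedPrize w y S = S.sup y := by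
  apply le_antisymm
  · rcases mem_availablePrizes.1 (presentedPrize_mem (w := w) (y := y) (S := S)).1 with h | ⟨i, hi, h⟩
    · simp [h]
    · exact h ▸ Finset.le_sup hi
  · exact Finset.sup_le fun i hi => le_presentedPrize hw (mem_availablePrizes.2 (Or.inr ⟨i, hi, rfl⟩))

end Available

/-! ### Integrability and resampling of one prize -/

section Integrability

variable {w : Contract} {n : ℕ} {A : Fin n → Project}

theorem Contract.DoublyMonotone.profit_mono (hw : w.DoublyMonotone) : Monotone w.profit := hw.2

/-- Monotone profit gives w(y) ≤ y + w(0), so the finite mean suffices. -/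
theorem Contract.DoublyMonotone.integrable_wage (hw : w.DoublyMonotone) (a : Project) :
    Integrable w.wage a.law := by
  refine Integrable.mono' (a.finite_mean.add (integrable_const (w.wage 0)))
    w.measurable_wage.aestronglyMeasurable (.of_forall fun y => ?_)
  have := hw.2 (zero_le (a := y))
  simp only [NNReal.coe_zero] at this
  rw [Real.norm_of_nonneg (w.limited_liability y), Pi.add_apply]
  linarith

theorem Contract.DoublyMonotone.integrable_profit (hw : w.DoublyMonotone) (a : Project) :
    Integrable w.profit a.law :=
  a.finite_mean.sub (hw.integrable_wage a)

theorem measurePreserving_prize (A : Fin n → Project) (i : Fin n) :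
    MeasurePreserving (fun y : Fin n → ℝ≥0 => y i) (prizeLaw A) (A i).law :=
  measurePreserving_eval _ i

theorem integrable_prize {f : ℝ≥0 → ℝ} {i : Fin n} (hf : Integrable f (A i).law) :
    Integrable (fun y => f (y i)) (prizeLaw A) :=
  (measurePreserving_prize A i).integrable_comp_of_integrable hf

theorem integral_prize {f : ℝ≥0 → ℝ} {i : Fin n} (hf : Integrable f (A i).law) :
    ∫ y, f (y i) ∂prizeLaw A = ∫ z, f z ∂(A i).law := by
  have h := measurePreserving_prize A i
  rw [← h.map_eq, integral_map h.measurable.aemeasurable (h.map_eq ▸ hf.aestronglyMeasurable)]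

/-- Integrating over all prizes amounts to integrating over them and then resampling one. -/
theorem integral_prizeLaw_update (i : Fin n) {F : (Fin n → ℝ≥0) → ℝ}
    (hF : Integrable F (prizeLaw A)) :
    Integrable (fun p : (Fin n → ℝ≥0) × ℝ≥0 => F (Function.update p.1 i p.2))
      ((prizeLaw A).prod (A i).law) ∧
    ∫ y, F y ∂prizeLaw A =
      ∫ y, ∫ z, F (Function.update y i z) ∂(A i).law ∂prizeLaw A := by
  have hmp : MeasurePreserving (fun p : (Fin n → ℝ≥0) × ℝ≥0 => Function.update p.1 i p.2)
      ((prizeLaw A).prod (A i).law) (prizeLaw A) :=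
    measurePreserving_update_pi (fun j => (A j).law) i
  have h2 : Integrable (fun p : (Fin n → ℝ≥0) × ℝ≥0 => F (Function.update p.1 i p.2))
      ((prizeLaw A).prod (A i).law) := hmp.integrable_comp_of_integrable hF
  refine ⟨h2, ?_⟩
  rw [← integral_prod _ h2]
  have h3 := integral_map (f := F) hmp.measurable.aemeasurable
    (hmp.map_eq ▸ hF.aestronglyMeasurable)
  rw [hmp.map_eq] at h3
  exact h3

theorem measurable_bestWage (S : Finset (Fin n)) : Measurable fun y => bestWage w y S := by
  induction S using Finset.induction_on with
  | empty => simp [bestWage_empty]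
  | insert i S _ ih =>
    simp only [bestWage_insert]
    exact ih.max (w.measurable_wage.comp (measurable_pi_apply i))

theorem integrable_bestWage (hw : w.DoublyMonotone) (S : Finset (Fin n)) :
    Integrable (fun y => bestWage w y S) (prizeLaw A) := by
  induction S using Finset.induction_on with
  | empty => simp [bestWage_empty]
  | insert i S _ ih =>
    simp only [bestWage_insert]
    exact ih.sup (integrable_prize (hw.integrable_wage (A i)))

theorem integrable_presentedPrize (hw : w.DoublyMonotone) (S : Finset (Fin n)) :
    Integrable (fun y => (presentedPrize w y S : ℝ)) (prizeLaw A) := by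
  simp only [presentedPrize_eq_sup hw]
  induction S using Finset.induction_on with
  | empty => simp
  | insert i S _ ih =>
    simp only [Finset.sup_insert, NNReal.coe_max]
    exact (integrable_prize (A i).finite_mean).sup ih

theorem integrable_profit_presentedPrize (hw : w.DoublyMonotone) (S : Finset (Fin n)) :
    Integrable (fun y => w.profit (presentedPrize w y S)) (prizeLaw A) := by
  simp only [Contract.profit, presentedPrize_mem.2]
  exact (integrable_presentedPrize hw S).sub (integrable_bestWage hw S)

theorem _root_.LipschitzWith.integrable_comp_real {Ω : Type*} [MeasurableSpace Ω] {μ : Measure Ω}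
    [IsFiniteMeasure μ] {g : ℝ → ℝ} (hg : LipschitzWith 1 g) {f : Ω → ℝ} (hf : Integrable f μ) :
    Integrable (fun y => g (f y)) μ := by
  refine Integrable.mono' (hf.norm.add (integrable_const |g 0|))
    (hg.continuous.comp_aestronglyMeasurable hf.1) (.of_forall fun y => ?_)
  have h := hg.dist_le_mul (f y) 0
  simp only [Real.dist_eq, NNReal.coe_one, one_mul, sub_zero] at h
  have h2 := abs_sub_abs_le_abs_sub (g (f y)) (g 0)
  simp only [Real.norm_eq_abs, Pi.add_apply]
  linarith

end Integrability

/-! ### Dependence of the search path on the prizes -/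

namespace Strategy

variable {n : ℕ} (σ : Strategy n) (w : Contract)

theorem opened_succ_of_none {y : Fin n → ℝ≥0} {k : ℕ}
    (h : σ.next (σ.opened w y k) (bestWage w y (σ.opened w y k)) = none) :
    σ.opened w y (k + 1) = σ.opened w y k := by
  simp [opened, h]

theorem opened_succ_of_some {y : Fin n → ℝ≥0} {k : ℕ} {i : Fin n}
    (h : σ.next (σ.opened w y k) (bestWage w y (σ.opened w y k)) = some i) :
    σ.opened w y (k + 1) = insert i (σ.opened w y k) := by
  simp [opened, h]

theorem opened_subset_succ (y : Fin n → ℝ≥0) (k : ℕ) :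
    σ.opened w y k ⊆ σ.opened w y (k + 1) := by
  rcases h : σ.next (σ.opened w y k) (bestWage w y (σ.opened w y k)) with _ | i
  · rw [σ.opened_succ_of_none w h]
  · rw [σ.opened_succ_of_some w h]
    exact Finset.subset_insert _ _

/-- Decisions consult only the boxes already opened. -/
theorem opened_update {y : Fin n → ℝ≥0} {i : Fin n} (t : ℝ≥0) {k : ℕ}
    (hi : i ∉ σ.opened w y k) : σ.opened w (Function.update y i t) k = σ.opened w y k := by
  induction k with
  | zero => rfl
  | succ k ih =>
    have hi' : i ∉ σ.opened w y k := fun h => hi (σ.opened_subset_succ w y k h)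
    simp only [opened, ih hi', bestWage_update hi']

theorem mem_opened_update (y : Fin n → ℝ≥0) (i : Fin n) (t : ℝ≥0) (k : ℕ) :
    i ∈ σ.opened w (Function.update y i t) k ↔ i ∈ σ.opened w y k := by
  constructor
  · intro h
    by_contra h'
    rw [σ.opened_update w t h'] at h
    exact h' h
  · intro h
    by_contra h'
    -- Restoring the original content turns the updated profile back into `y`.
    have := σ.opened_update w (y i) h'
    rw [Function.update_idem, Function.update_eq_self] at this
    exact h' (this ▸ h)

theorem next_opened_update_eq_some (y : Fin n → ℝ≥0) (i : Fin n) (t : ℝ≥0) (k : ℕ) :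
    σ.next (σ.opened w (Function.update y i t) k)
        (bestWage w (Function.update y i t) (σ.opened w (Function.update y i t) k)) = some i ↔
      σ.next (σ.opened w y k) (bestWage w y (σ.opened w y k)) = some i := by
  by_cases hi : i ∈ σ.opened w y k
  · have hi' := (σ.mem_opened_update w y i t k).2 hi
    exact ⟨fun h => absurd hi' (σ.not_mem_of_next _ _ _ h),
      fun h => absurd hi (σ.not_mem_of_next _ _ _ h)⟩
  · rw [σ.opened_update w t hi, bestWage_update hi]

/-- A search still running has opened a new box at every step; this is why `n` steps are enough. -/
theorem stopped_or_card_opened (y : Fin n → ℝ≥0) (k : ℕ) :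
    σ.next (σ.opened w y k) (bestWage w y (σ.opened w y k)) = none ∨
      (σ.opened w y k).card = k := by
  induction k with
  | zero => right; rfl
  | succ k ih =>
    rcases h : σ.next (σ.opened w y k) (bestWage w y (σ.opened w y k)) with _ | i
    · left
      rwa [σ.opened_succ_of_none w h]
    · right
      rw [σ.opened_succ_of_some w h, Finset.card_insert_of_notMem (σ.not_mem_of_next _ _ _ h)]
      rcases ih with ih | ih
      · simp [h] at ih
      · rw [ih]

theorem stopped_or_finalOpened_eq_univ (y : Fin n → ℝ≥0) :
    σ.next (σ.finalOpened w y) (bestWage w y (σ.finalOpened w y)) = none ∨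
      σ.finalOpened w y = Finset.univ :=
  (σ.stopped_or_card_opened w y n).imp_right fun h => by
    rw [← Finset.card_eq_iff_eq_univ, Fintype.card_fin]
    exact h

theorem measurableSet_next_eq (S : Finset (Fin n)) (o : Option (Fin n)) :
    MeasurableSet {v : ℝ | σ.next S v = o} := by
  rcases o with _ | i
  · have : {v : ℝ | σ.next S v = none} = (⋃ i, {v : ℝ | σ.next S v = some i})ᶜ := by
      ext v
      simp only [Set.mem_ofPred_eq, Set.mem_compl_iff, Set.mem_iUnion, not_exists]
      constructor
      · intro h; simp [h]
      · intro h
        rcases h' : σ.next S v with _ | i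
        · rfl
        · exact absurd h' (h i)
    rw [this]
    exact (MeasurableSet.iUnion fun i => σ.measurableSet_next S i).compl
  · exact σ.measurableSet_next S i

theorem measurableSet_opened_next (k : ℕ) (S : Finset (Fin n)) (o : Option (Fin n))
    (hS : MeasurableSet {y | σ.opened w y k = S}) :
    MeasurableSet {y | σ.opened w y k = S ∧ σ.next S (bestWage w y S) = o} :=
  hS.inter (measurable_bestWage S (σ.measurableSet_next_eq S o))

theorem measurableSet_opened (k : ℕ) :
    ∀ S : Finset (Fin n), MeasurableSet {y : Fin n → ℝ≥0 | σ.opened w y k = S} := by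
  induction k with
  | zero => intro S; simp [opened]
  | succ k ih =>
    intro S
    have : {y : Fin n → ℝ≥0 | σ.opened w y (k + 1) = S} =
        ⋃ (T : Finset (Fin n)) (o : Option (Fin n)) (_ : o.elim T (fun i => insert i T) = S),
          {y | σ.opened w y k = T ∧ σ.next T (bestWage w y T) = o} := by
      ext y
      simp only [Set.mem_ofPred_eq, Set.mem_iUnion, exists_prop]
      constructor
      · intro h
        refine ⟨_, _, ?_, rfl, rfl⟩
        rcases h' : σ.next (σ.opened w y k) (bestWage w y (σ.opened w y k)) with _ | i
        · rw [σ.opened_succ_of_none w h'] at h; exact h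
        · rw [σ.opened_succ_of_some w h'] at h; exact h
      · rintro ⟨_, o, h, rfl, ho⟩
        rcases o with _ | i
        · rw [σ.opened_succ_of_none w ho]; exact h
        · rw [σ.opened_succ_of_some w ho]; exact h
    rw [this]
    exact .iUnion fun T => .iUnion fun o => .iUnion fun _ =>
      σ.measurableSet_opened_next w k T o (ih T)

theorem measurableSet_next_opened (k : ℕ) (o : Option (Fin n)) : MeasurableSet
    {y : Fin n → ℝ≥0 | σ.next (σ.opened w y k) (bestWage w y (σ.opened w y k)) = o} := by
  have : {y : Fin n → ℝ≥0 | σ.next (σ.opened w y k) (bestWage w y (σ.opened w y k)) = o} =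
      ⋃ T, {y | σ.opened w y k = T ∧ σ.next T (bestWage w y T) = o} := by
    ext y
    simp
  rw [this]
  exact .iUnion fun T => σ.measurableSet_opened_next w k T o (σ.measurableSet_opened w k T)

theorem measurableSet_mem_finalOpened (i : Fin n) :
    MeasurableSet {y : Fin n → ℝ≥0 | i ∈ σ.finalOpened w y} := by
  have : {y : Fin n → ℝ≥0 | i ∈ σ.finalOpened w y} =
      ⋃ (T : Finset (Fin n)) (_ : i ∈ T), {y | σ.opened w y n = T} := by
    ext y
    simp [finalOpened]
  rw [this]
  exact .iUnion fun T => .iUnion fun _ => σ.measurableSet_opened w n T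

variable {w} (A : Fin n → Project)

theorem integrable_profit_finalPrize (hw : w.DoublyMonotone) :
    Integrable (fun y => w.profit (σ.finalPrize w y)) (prizeLaw A) :=
  integrable_finite_choice (σ.measurableSet_opened w n)
    fun S => integrable_profit_presentedPrize hw S

theorem integrable_agent_payoff (hw : w.DoublyMonotone) :
    Integrable (fun y => w.wage (σ.finalPrize w y) -
      ∑ i ∈ σ.finalOpened w y, ((A i).cost : ℝ)) (prizeLaw A) :=
  integrable_finite_choice (σ.measurableSet_opened w n)
    (f := fun S y => w.wage (presentedPrize w y S) - ∑ i ∈ S, ((A i).cost : ℝ)) fun S => by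
      simp only [presentedPrize_mem.2]
      exact (integrable_bestWage hw S).sub (integrable_const _)

variable (w) {A}

/-- Whether a box is opened does not depend on its content. -/
theorem integral_ite_mem_finalOpened (i : Fin n) {f : ℝ≥0 → ℝ} (hf : Integrable f (A i).law)
    (m : ℝ) :
    Integrable (fun y => if i ∈ σ.finalOpened w y then f (y i) else m) (prizeLaw A) ∧
    ∫ y, (if i ∈ σ.finalOpened w y then f (y i) else m) ∂prizeLaw A =
      (prizeLaw A).real {y | i ∈ σ.finalOpened w y} * ∫ z, f z ∂(A i).law +
        (1 - (prizeLaw A).real {y | i ∈ σ.finalOpened w y}) * m := by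
  set D : Set (Fin n → ℝ≥0) := {y | i ∈ σ.finalOpened w y} with hD
  have hDm : MeasurableSet D := σ.measurableSet_mem_finalOpened w i
  have hint : Integrable (fun y => if i ∈ σ.finalOpened w y then f (y i) else m) (prizeLaw A) :=
    Integrable.piecewise (s := D) hDm (integrable_prize hf).integrableOn
      (integrable_const m).integrableOn
  refine ⟨hint, ?_⟩
  obtain ⟨-, h1⟩ := integral_prizeLaw_update i hint
  have hmem : ∀ y z, i ∈ σ.finalOpened w (Function.update y i z) ↔ i ∈ σ.finalOpened w y :=
    fun y z => σ.mem_opened_update w y i z n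
  simp only [hmem, Function.update_self] at h1
  rw [h1]
  -- The event ignores the resampled coordinate, so the inner integral is either the mean of `f` or
  -- `m`.
  have h3 : ∀ y, ∫ z, (if i ∈ σ.finalOpened w y then f z else m) ∂(A i).law =
      D.indicator (fun _ => ∫ z, f z ∂(A i).law - m) y + m := by
    intro y
    by_cases h : i ∈ σ.finalOpened w y
    · simp [h, hD]
    · simp [h, hD]
  simp only [h3]
  rw [integral_add ((integrable_const _).indicator hDm) (integrable_const _),
    integral_indicator hDm]
  simp
  ring

end Strategy

end DelegatedSearch

namespace DelegatedSearch

/-! ### Bellman values and optimal strategies -/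

section DynamicProgramming

variable (w : Contract) {n : ℕ} (A : Fin n → Project)

/-- The agent's optimal continuation payoff with wage `v` in hand and the boxes in `S` opened,
when at most the given number of further boxes can be opened. -/
noncomputable def valueWithin : ℕ → Finset (Fin n) → ℝ → ℝ
  | 0, _, v => v
  | k + 1, S, v => (Finset.insertNone Sᶜ).sup' ⟨none, by simp⟩ fun o => o.elim v fun i =>
      ∫ z, valueWithin k (insert i S) (max v (w.wage z)) ∂(A i).law - (A i).cost

/-- The agent's optimal continuation payoff with wage `v` in hand and the boxes in `S` opened. -/
noncomputable def searchValue (S : Finset (Fin n)) (v : ℝ) : ℝ :=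
  valueWithin w A Sᶜ.card S v

/-- The agent's payoff from opening box `i` and searching optimally afterwards. -/
noncomputable def openValue (S : Finset (Fin n)) (i : Fin n) (v : ℝ) : ℝ :=
  ∫ z, searchValue w A (insert i S) (max v (w.wage z)) ∂(A i).law - (A i).cost

variable {w}

theorem lipschitzWith_integral_max {V : ℝ → ℝ} (hV : LipschitzWith 1 V) (hw : w.DoublyMonotone)
    (a : Project) (c : ℝ) :
    LipschitzWith 1 fun v => ∫ z, V (max v (w.wage z)) ∂a.law - c := by
  have hint : ∀ v, Integrable (fun z => V (max v (w.wage z))) a.law := fun v =>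
    hV.integrable_comp_real ((integrable_const v).sup (hw.integrable_wage a))
  refine LipschitzWith.of_le_add fun u v => ?_
  have : ∫ z, V (max u (w.wage z)) ∂a.law ≤ ∫ z, (V (max v (w.wage z)) + dist u v) ∂a.law := by
    refine integral_mono (hint u) ((hint v).add (integrable_const _)) fun z => ?_
    have h1 := hV.dist_le_mul (max u (w.wage z)) (max v (w.wage z))
    rw [NNReal.coe_one, one_mul, Real.dist_eq, Real.dist_eq] at h1
    have h2 := abs_max_sub_max_le_abs u v (w.wage z)
    have h3 := le_abs_self (V (max u (w.wage z)) - V (max v (w.wage z)))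
    change V (max u (w.wage z)) ≤ V (max v (w.wage z)) + dist u v
    rw [Real.dist_eq]
    linarith
  rw [integral_add (hint v) (integrable_const _)] at this
  simp only [integral_const, probReal_univ, one_smul] at this
  linarith

/-- Taking the maximum with a wage, averaging and finite maxima all preserve the constant 1. This
yields linear growth for integrability and continuity for measurable choices. -/
theorem lipschitzWith_valueWithin (hw : w.DoublyMonotone) (k : ℕ) :
    ∀ S, LipschitzWith 1 (valueWithin w A k S) := by
  induction k with
  | zero => exact fun S => LipschitzWith.id
  | succ k ih =>
    refine fun S => LipschitzWith.of_le_add fun u v => ?_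
    simp only [valueWithin]
    refine Finset.sup'_le _ _ fun o ho => ?_
    have h := Finset.le_sup' (fun o : Option (Fin n) => o.elim v fun i =>
      ∫ z, valueWithin w A k (insert i S) (max v (w.wage z)) ∂(A i).law - (A i).cost) ho
    refine le_trans ?_ (add_le_add_left h _)
    rcases o with _ | i
    · simp only [Option.elim_none, Real.dist_eq]
      linarith [le_abs_self (u - v)]
    · simp only [Option.elim_some]
      have := (lipschitzWith_integral_max (ih (insert i S)) hw (A i) (A i).cost).dist_le_mul u v
      simp only [NNReal.coe_one, one_mul] at this
      rw [Real.dist_eq] at this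
      linarith [(le_abs_self _).trans this]

theorem lipschitzWith_searchValue (hw : w.DoublyMonotone) (S : Finset (Fin n)) :
    LipschitzWith 1 (searchValue w A S) :=
  lipschitzWith_valueWithin A hw _ S

theorem lipschitzWith_openValue (hw : w.DoublyMonotone) (S : Finset (Fin n)) (i : Fin n) :
    LipschitzWith 1 (openValue w A S i) :=
  lipschitzWith_integral_max (lipschitzWith_searchValue A hw _) hw _ _

theorem integrable_searchValue_max (hw : w.DoublyMonotone) (S : Finset (Fin n)) (a : Project)
    (v : ℝ) : Integrable (fun z => searchValue w A S (max v (w.wage z))) a.law :=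
  (lipschitzWith_searchValue A hw S).integrable_comp_real
    ((integrable_const v).sup (hw.integrable_wage a))

theorem searchValue_univ (v : ℝ) : searchValue w A Finset.univ v = v := by
  simp [searchValue, valueWithin]

/-- The Bellman equation: the horizon equals the number of closed boxes and drops by one with each
opening, so it never binds. -/
theorem searchValue_of_notMem {S : Finset (Fin n)} {i : Fin n} (hi : i ∉ S) (v : ℝ) :
    searchValue w A S v = (Finset.insertNone Sᶜ).sup' ⟨none, by simp⟩ fun o =>
      o.elim v fun i => openValue w A S i v := by
  have hcard : ∀ j ∉ S, (insert j S)ᶜ.card = Sᶜ.card - 1 := fun j hj => by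
    rw [Finset.compl_insert, Finset.card_erase_of_mem (by simpa using hj)]
  have hpos : 0 < Sᶜ.card := Finset.card_pos.2 ⟨i, by simpa using hi⟩
  have h : Sᶜ.card = (Sᶜ.card - 1) + 1 := by omega
  rw [searchValue, h, valueWithin]
  refine Finset.sup'_congr _ rfl fun o ho => ?_
  rcases o with _ | j
  · rfl
  · have hj : j ∉ S := by simpa using ho
    simp only [Option.elim_some, openValue, searchValue, hcard j hj]

theorem le_searchValue (S : Finset (Fin n)) (v : ℝ) : v ≤ searchValue w A S v := by
  by_cases h : ∃ i, i ∉ S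
  · obtain ⟨i, hi⟩ := h
    rw [searchValue_of_notMem A hi]
    exact Finset.le_sup' (fun o : Option (Fin n) => o.elim v fun i => openValue w A S i v)
      (Finset.none_mem_insertNone)
  · have : S = Finset.univ := Finset.eq_univ_iff_forall.2 (by simpa using h)
    rw [this, searchValue_univ]

theorem openValue_le_searchValue {S : Finset (Fin n)} {i : Fin n} (hi : i ∉ S) (v : ℝ) :
    openValue w A S i v ≤ searchValue w A S v := by
  rw [searchValue_of_notMem A hi]
  exact Finset.le_sup' (fun o : Option (Fin n) => o.elim v fun i => openValue w A S i v)
    (b := some i) (by simpa using hi)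

theorem searchValue_eq_or (S : Finset (Fin n)) (v : ℝ) :
    searchValue w A S v = v ∨ ∃ i ∉ S, openValue w A S i v = searchValue w A S v := by
  by_cases h : ∃ i, i ∉ S
  · obtain ⟨i, hi⟩ := h
    rw [searchValue_of_notMem A hi]
    obtain ⟨o, ho, h⟩ := Finset.exists_mem_eq_sup' (s := Finset.insertNone Sᶜ) ⟨none, by simp⟩
      (fun o : Option (Fin n) => o.elim v fun i => openValue w A S i v)
    rw [h]
    rcases o with _ | j
    · exact Or.inl rfl
    · exact Or.inr ⟨j, by simpa using ho, rfl⟩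
  · have : S = Finset.univ := Finset.eq_univ_iff_forall.2 (by simpa using h)
    left
    rw [this, searchValue_univ]

variable {A}

/-- The expected change of the search value net of costs in one step of a search. -/
theorem integral_step (hw : w.DoublyMonotone) (σ : Strategy n) (k : ℕ) :
    let M := fun (k : ℕ) (y : Fin n → ℝ≥0) =>
      searchValue w A (σ.opened w y k) (bestWage w y (σ.opened w y k)) -
        ∑ i ∈ σ.opened w y k, ((A i).cost : ℝ)
    (∀ k, Integrable (M k) (prizeLaw A)) ∧
    ∫ y, M (k + 1) y ∂prizeLaw A - ∫ y, M k y ∂prizeLaw A = ∑ i, ∫ y,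
      (if σ.next (σ.opened w y k) (bestWage w y (σ.opened w y k)) = some i then
        openValue w A (σ.opened w y k) i (bestWage w y (σ.opened w y k)) -
          searchValue w A (σ.opened w y k) (bestWage w y (σ.opened w y k))
        else 0) ∂prizeLaw A := by
  intro M
  have hM : ∀ k, Integrable (M k) (prizeLaw A) := fun k =>
    integrable_finite_choice (σ.measurableSet_opened w k)
      (f := fun S y => searchValue w A S (bestWage w y S) - ∑ i ∈ S, ((A i).cost : ℝ))
      fun S => ((lipschitzWith_searchValue A hw S).integrable_comp_real
        (integrable_bestWage hw S)).sub (integrable_const _)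
  refine ⟨hM, ?_⟩
  let T : Fin n → (Fin n → ℝ≥0) → ℝ := fun i y =>
    if σ.next (σ.opened w y k) (bestWage w y (σ.opened w y k)) = some i then
      M (k + 1) y - M k y else 0
  have hT : ∀ i, Integrable (T i) (prizeLaw A) := fun i =>
    Integrable.piecewise (s := {y | σ.next (σ.opened w y k)
      (bestWage w y (σ.opened w y k)) = some i}) (σ.measurableSet_next_opened w k (some i))
      ((hM (k + 1)).sub (hM k)).integrableOn (integrable_const 0).integrableOn
  have hsum : ∀ y, M (k + 1) y - M k y = ∑ i, T i y := by
    intro y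
    rcases h : σ.next (σ.opened w y k) (bestWage w y (σ.opened w y k)) with _ | i
    · simp [T, M, h, σ.opened_succ_of_none w h]
    · simp [T, h]
  rw [← integral_sub (hM (k + 1)) (hM k)]
  simp only [hsum]
  rw [integral_finsetSum _ fun i _ => hT i]
  refine Finset.sum_congr rfl fun i _ => ?_
  -- The decision to open box `i` precedes sight of its content, so the content can be redrawn;
  -- averaging over the redraw produces `openValue`.
  rw [(integral_prizeLaw_update i (hT i)).2]
  refine integral_congr_ae (.of_forall fun y => ?_)
  simp only [T, σ.next_opened_update_eq_some]
  split_ifs with h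
  · have hi := σ.not_mem_of_next _ _ _ h
    have hstep : ∀ z, M (k + 1) (Function.update y i z) - M k (Function.update y i z) =
        searchValue w A (insert i (σ.opened w y k))
          (max (bestWage w y (σ.opened w y k)) (w.wage z)) - ((A i).cost +
          searchValue w A (σ.opened w y k) (bestWage w y (σ.opened w y k))) := by
      intro z
      have h' := (σ.next_opened_update_eq_some w y i z k).2 h
      simp only [M]
      rw [σ.opened_succ_of_some w h', σ.opened_update w z hi, Finset.sum_insert hi,
        bestWage_insert, bestWage_update hi, Function.update_self]
      ring
    simp only [hstep]
    rw [integral_sub (integrable_searchValue_max A hw _ _ _) (integrable_const _)]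
    simp [openValue]
    ring
  · simp

theorem integral_start (σ : Strategy n) :
    ∫ y, (searchValue w A (σ.opened w y 0) (bestWage w y (σ.opened w y 0)) -
        ∑ i ∈ σ.opened w y 0, ((A i).cost : ℝ)) ∂prizeLaw A =
      searchValue w A ∅ (w.wage 0) := by
  simp [Strategy.opened, bestWage_empty]

/-- A supermartingale argument: continuation value net of costs never rises in expectation, and at
the end it dominates the actual payoff. -/
theorem agentValue_le_searchValue (hw : w.DoublyMonotone) (σ : Strategy n) :
    agentValue w A σ ≤ searchValue w A ∅ (w.wage 0) := by
  have hanti := antitone_nat_of_succ_le (f := fun k => ∫ y,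
    (searchValue w A (σ.opened w y k) (bestWage w y (σ.opened w y k)) -
      ∑ i ∈ σ.opened w y k, ((A i).cost : ℝ)) ∂prizeLaw A) fun k => by
    rw [← sub_nonpos, (integral_step hw σ k).2]
    refine Finset.sum_nonpos fun i _ => integral_nonpos fun y => ?_
    change ite _ _ _ ≤ (0 : ℝ)
    split_ifs with h
    · exact sub_nonpos.2 (openValue_le_searchValue A (σ.not_mem_of_next _ _ _ h) _)
    · exact le_rfl
  have h := hanti (Nat.zero_le n)
  simp only [integral_start] at h
  refine le_trans (integral_mono (σ.integrable_agent_payoff A hw) ((integral_step hw σ 0).1 n)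
    fun y => ?_) h
  exact sub_le_sub_right (presentedPrize_mem.2.le.trans (le_searchValue A _ _)) _

/-- When every action attains the Bellman maximum, the supermartingale bound holds with equality
throughout. -/
theorem agentValue_eq_searchValue (hw : w.DoublyMonotone) (σ : Strategy n)
    (hopen : ∀ S v i, σ.next S v = some i → openValue w A S i v = searchValue w A S v)
    (hnone : ∀ S v, σ.next S v = none → searchValue w A S v = v) :
    agentValue w A σ = searchValue w A ∅ (w.wage 0) := by
  have hconst : ∀ k, ∫ y,
    (searchValue w A (σ.opened w y k) (bestWage w y (σ.opened w y k)) -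
      ∑ i ∈ σ.opened w y k, ((A i).cost : ℝ)) ∂prizeLaw A =
      searchValue w A ∅ (w.wage 0) := by
    intro k
    induction k with
    | zero => exact integral_start σ
    | succ k ih =>
      rw [← ih, ← sub_eq_zero, (integral_step hw σ k).2]
      refine Finset.sum_eq_zero fun i _ => integral_eq_zero_of_ae (.of_forall fun y => ?_)
      change ite _ _ _ = (0 : ℝ)
      split_ifs with h
      · exact sub_eq_zero.2 (hopen _ _ _ h)
      · rfl
  rw [← hconst n]
  refine integral_congr_ae (.of_forall fun y => ?_)
  have : w.wage (σ.finalPrize w y) =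
      searchValue w A (σ.finalOpened w y) (bestWage w y (σ.finalOpened w y)) := by
    rw [Strategy.finalPrize, presentedPrize_mem.2]
    rcases σ.stopped_or_finalOpened_eq_univ w y with h | h
    · exact (hnone _ _ h).symm
    · rw [h, searchValue_univ]
  simp only [this]
  rfl

variable (A)

/-- There is an optimal strategy that stops only if opening any further box is a strict loss. -/
theorem exists_optimal_eager (hw : w.DoublyMonotone) :
    ∃ σ : Strategy n, agentValue w A σ = searchValue w A ∅ (w.wage 0) ∧
      ∀ S v, σ.next S v = none → ∀ i ∉ S, openValue w A S i v < v := by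
  classical
  let P : Finset (Fin n) → ℝ → Fin n → Prop := fun S v i =>
    i ∉ S ∧ openValue w A S i v = searchValue w A S v
  have hPm : ∀ S i, MeasurableSet {v | P S v i} := fun S i =>
    (MeasurableSet.const _).inter (measurableSet_eq_fun
      (lipschitzWith_openValue A hw S i).continuous.measurable
      (lipschitzWith_searchValue A hw S).continuous.measurable)
  -- Taking the first box that attains the maximum keeps the choice measurable; stopping only when
  -- there is none makes it eager.
  let f : Finset (Fin n) → ℝ → Option (Fin n) := fun S v => Fin.find? fun i => decide (P S v i)
  have hf : ∀ S v i, f S v = some i ↔ P S v i ∧ ∀ j < i, ¬ P S v j := fun S v i => by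
    simp [f]
  have hfn : ∀ S v, f S v = none ↔ ∀ i, ¬ P S v i := fun S v => by
    simp [f]
  let σ : Strategy n :=
    { next := f
      not_mem_of_next := fun S v i h => ((hf S v i).1 h).1.1
      measurableSet_next := fun S i => by
        have : {v | f S v = some i} = {v | P S v i} ∩ ⋂ (j) (_ : j < i), {v | P S v j}ᶜ := by
          ext v
          simp [hf]
        rw [this]
        exact (hPm S i).inter (.iInter fun j => .iInter fun _ => (hPm S j).compl) }
  have hnone : ∀ S v, σ.next S v = none → searchValue w A S v = v := fun S v h =>
    (searchValue_eq_or A S v).resolve_right fun ⟨i, hi, he⟩ => (hfn S v).1 h i ⟨hi, he⟩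
  refine ⟨σ, agentValue_eq_searchValue hw σ (fun S v i h => ((hf S v i).1 h).1.2) hnone,
    fun S v h i hi => ?_⟩
  refine lt_of_le_of_ne ((openValue_le_searchValue A hi v).trans_eq (hnone S v h)) fun he => ?_
  exact (hfn S v).1 h i ⟨hi, he.trans (hnone S v h).symm⟩

theorem mem_optimalStrategies_iff (hw : w.DoublyMonotone) (σ : Strategy n) :
    σ ∈ optimalStrategies w A ↔ agentValue w A σ = searchValue w A ∅ (w.wage 0) := by
  obtain ⟨τ, hτ, -⟩ := exists_optimal_eager A hw
  constructor
  · intro h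
    exact le_antisymm (agentValue_le_searchValue hw σ) (hτ ▸ h τ)
  · intro h τ'
    exact h ▸ agentValue_le_searchValue hw τ'

end DynamicProgramming

end DelegatedSearch

namespace DelegatedSearch

/-! ### The index as a threshold for opening a box -/

section Index

variable {w : Contract}

theorem integrable_max_wage_sub (hw : w.DoublyMonotone) (a : Project) (r : ℝ) :
    Integrable (fun z => max (w.wage z - r) 0) a.law :=
  ((hw.integrable_wage a).sub (integrable_const r)).sup (integrable_const 0)

theorem integral_max_wage (hw : w.DoublyMonotone) (a : Project) (r : ℝ) :
    ∫ z, max r (w.wage z) ∂a.law = ∫ z, max (w.wage z - r) 0 ∂a.law + r := by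
  have : ∀ z, max r (w.wage z) = max (w.wage z - r) 0 + r := fun z => by
    rw [max_add]
    simp [max_comm]
  simp only [this]
  rw [integral_add (integrable_max_wage_sub hw a r) (integrable_const r)]
  simp

theorem continuous_integral_max_wage_sub (hw : w.DoublyMonotone) (a : Project) :
    Continuous fun r => ∫ z, max (w.wage z - r) 0 ∂a.law := by
  have h := (lipschitzWith_integral_max (LipschitzWith.id (α := ℝ)) hw a 0).continuous
  have : (fun r => ∫ z, max (w.wage z - r) 0 ∂a.law) =
      fun r => (∫ z, id (max r (w.wage z)) ∂a.law - 0) - r := by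
    funext r
    simp only [id, integral_max_wage hw]
    ring
  rw [this]
  exact h.sub continuous_id

/-- Otherwise the continuous expected gain would cross the cost strictly below `v`, giving a
solution smaller than the index. -/
theorem cost_le_of_le_inducedIndex (hw : w.DoublyMonotone) (a : Project) {v : ℝ}
    (h : (v : EReal) ≤ inducedIndex w a) :
    (a.cost : ℝ) ≤ ∫ z, max (w.wage z - v) 0 ∂a.law := by
  by_contra! hlt
  -- Wages are nonnegative, so at any level up to minus the cost the gain already covers the cost.
  have hlow : (a.cost : ℝ) ≤ ∫ z, max (w.wage z - min v (-a.cost)) 0 ∂a.law := by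
    have : ∫ _, (a.cost : ℝ) ∂a.law ≤ ∫ z, max (w.wage z - min v (-a.cost)) 0 ∂a.law :=
      integral_mono (integrable_const _) (integrable_max_wage_sub hw a _) fun z =>
        le_max_of_le_left (by linarith [w.limited_liability z, min_le_right v (-(a.cost : ℝ))])
    simpa using this
  obtain ⟨r, hr, hre⟩ := intermediate_value_Icc' (min_le_left v (-(a.cost : ℝ)))
    (continuous_integral_max_wage_sub hw a).continuousOn ⟨hlt.le, hlow⟩
  have hrv : r < v := lt_of_le_of_ne hr.2 fun he => hlt.ne (he ▸ hre)
  have : inducedIndex w a ≤ (r : EReal) := sInf_le ⟨r, hre.symm, rfl⟩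
  exact (h.trans this).not_gt (by exact_mod_cast hrv)

/-- Above a solution `r` the expected gain falls strictly, unless the wage is almost surely at most
`r`. That exception forces zero cost: opening may then be costless, but finds nothing that pays `v`.
-/
theorem of_inducedIndex_lt (hw : w.DoublyMonotone) (a : Project) {v : ℝ}
    (h : inducedIndex w a < (v : EReal)) :
    (∀ᵐ z ∂a.law, w.wage z < v) ∨ ∫ z, max (w.wage z - v) 0 ∂a.law < a.cost := by
  obtain ⟨_, ⟨r, hr, rfl⟩, hrv⟩ := sInf_lt_iff.1 h
  have hrv : r < v := EReal.coe_lt_coe_iff.1 hrv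
  have hr : (a.cost : ℝ) = ∫ z, max (w.wage z - r) 0 ∂a.law := hr
  by_cases hae : ∀ᵐ z ∂a.law, w.wage z ≤ r
  · exact Or.inl (hae.mono fun z hz => hz.trans_lt hrv)
  · right
    rw [hr, ← sub_pos, ← integral_sub (integrable_max_wage_sub hw a r)
      (integrable_max_wage_sub hw a v)]
    have hle : ∀ z, 0 ≤ max (w.wage z - r) 0 - max (w.wage z - v) 0 := fun z =>
      sub_nonneg.2 (max_le_max_right _ (by linarith))
    rw [integral_pos_iff_support_of_nonneg hle
      ((integrable_max_wage_sub hw a r).sub (integrable_max_wage_sub hw a v))]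
    refine pos_iff_ne_zero.2 fun h0 => hae ?_
    refine measure_mono_null (fun z hz => ?_) h0
    have hz : r < w.wage z := not_le.1 hz
    refine (sub_pos.2 ?_).ne'
    rw [max_eq_left (by linarith : 0 ≤ w.wage z - r)]
    exact max_lt (by linarith) (by linarith)

end Index

/-! ### Bounds on the principal's payoff -/

section Payoffs

variable {w : Contract} {n : ℕ} {A : Fin n → Project}

/-- With no unknown projects the principal gets at most the expected profit of the known one. -/
theorem principalPayoff_single_le (hw : w.DoublyMonotone) (a : Project) :
    principalPayoff w ![a] ≤ ((∫ z, w.profit z ∂a.law : ℝ) : EReal) := by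
  refine iSup₂_le fun σ _ => EReal.coe_le_coe_iff.2 ?_
  have h := integral_prize (A := ![a]) (i := 0) (hw.integrable_profit a)
  refine le_trans (integral_mono (σ.integrable_profit_finalPrize ![a] hw)
    (integrable_prize (A := ![a]) (i := 0) (hw.integrable_profit a)) fun y => ?_) h.le
  refine hw.profit_mono ?_
  rw [Strategy.finalPrize, presentedPrize_eq_sup hw]
  exact Finset.sup_le fun i _ => by rw [Subsingleton.elim i 0]

/-- Almost surely no prize above `x` is presented: either the known box cannot pay as much as `x`,
or opening it is a strict loss that optimal play avoids almost surely. -/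
theorem principalPayoff_safe_le (hw : w.DoublyMonotone) (a : Project) {x : ℝ≥0}
    (hx : inducedIndex w a < (w.wage x : EReal)) :
    principalPayoff w ![a, Project.safe x] ≤ (w.profit x : EReal) := by
  refine iSup₂_le fun σ hσ => EReal.coe_le_coe_iff.2 ?_
  set A : Fin 2 → Project := ![a, Project.safe x] with hA
  rw [mem_optimalStrategies_iff A hw] at hσ
  have hsafe : ∀ᵐ y ∂prizeLaw A, y 1 = x := by
    have : ∀ᵐ z ∂(A 1).law, z = x := by
      change ∀ᵐ z ∂Measure.dirac x, z = x
      simp [ae_dirac_eq]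
    exact (measurePreserving_prize A 1).quasiMeasurePreserving.ae this
  have hprize : ∀ y : Fin 2 → ℝ≥0, y 1 = x → (0 ∈ σ.finalOpened w y → y 0 ≤ x) →
      σ.finalPrize w y ≤ x := by
    intro y h1 h0
    rw [Strategy.finalPrize, presentedPrize_eq_sup hw]
    refine Finset.sup_le fun i hi => ?_
    fin_cases i
    · exact h0 hi
    · exact h1.le
  have hmain : ∀ᵐ y ∂prizeLaw A, σ.finalPrize w y ≤ x := by
    rcases of_inducedIndex_lt hw a hx with h | h
    · have h0 : ∀ᵐ y ∂prizeLaw A, w.wage (y 0) < w.wage x :=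
        (measurePreserving_prize A 0).quasiMeasurePreserving.ae h
      filter_upwards [hsafe, h0] with y h1 h0
      exact hprize y h1 fun _ => (hw.1.reflect_lt h0).le
    · have hbest : w.wage x ≤ agentValue w A σ := by
        rw [hσ]
        refine le_trans ?_ (openValue_le_searchValue A (Finset.notMem_empty 1) _)
        have hval : openValue w A ∅ 1 (w.wage 0) =
            searchValue w A (insert 1 ∅) (max (w.wage 0) (w.wage x)) := by
          simp [openValue, hA, Project.safe]
        rw [hval]
        exact (le_max_right _ _).trans (le_searchValue A _ _)
      obtain ⟨hint, heq⟩ := σ.integral_ite_mem_finalOpened w (A := A) 0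
        (f := fun z => max (w.wage x) (w.wage z) - a.cost)
        (((integrable_const _).sup (hw.integrable_wage a)).sub (integrable_const _)) (w.wage x)
      -- Granting the agent `x` for free even where the safe box stays closed only raises this
      -- bound.
      have hle : agentValue w A σ ≤ ∫ y, (if 0 ∈ σ.finalOpened w y then
          max (w.wage x) (w.wage (y 0)) - a.cost else w.wage x) ∂prizeLaw A := by
        refine integral_mono_ae (σ.integrable_agent_payoff A hw) hint ?_
        filter_upwards [hsafe] with y h1
        have hcost : ∀ i ∈ σ.finalOpened w y, (0 : ℝ) ≤ ((A i).cost : ℝ) :=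
          fun i _ => NNReal.coe_nonneg _
        split_ifs with h0
        · refine sub_le_sub ?_ (Finset.single_le_sum hcost h0)
          rw [← hw.1.map_max]
          refine hw.1 ?_
          rw [Strategy.finalPrize, presentedPrize_eq_sup hw]
          refine Finset.sup_le fun i _ => ?_
          fin_cases i
          · exact le_max_right _ _
          · exact h1.le.trans (le_max_left _ _)
        · have := hw.1 (hprize y h1 fun h => absurd h h0)
          linarith [Finset.sum_nonneg hcost]
      have hf : ∫ z, (max (w.wage x) (w.wage z) - a.cost) ∂(A 0).law < w.wage x := by
        change ∫ z, (max (w.wage x) (w.wage z) - (a.cost : ℝ)) ∂a.law < w.wage x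
        have hmax : Integrable (fun z => max (w.wage x) (w.wage z)) a.law :=
          (integrable_const _).sup (hw.integrable_wage a)
        rw [integral_sub hmax (integrable_const _), integral_max_wage hw]
        simp only [integral_const, probReal_univ, one_smul]
        linarith
      -- Opening with positive probability would pull the bound strictly below `w.wage x`, which the
      -- agent can secure.
      have hq : (prizeLaw A).real {y | 0 ∈ σ.finalOpened w y} = 0 := by
        refine le_antisymm ?_ measureReal_nonneg
        by_contra! hq
        rw [heq] at hle
        nlinarith
      have hnot : ∀ᵐ y ∂prizeLaw A, 0 ∉ σ.finalOpened w y := by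
        rw [ae_iff]
        simpa [measureReal_eq_zero_iff] using hq
      filter_upwards [hsafe, hnot] with y h1 h0
      exact hprize y h1 fun h => absurd h h0
  have : principalValue w A σ ≤ ∫ _, w.profit x ∂prizeLaw A :=
    integral_mono_ae (σ.integrable_profit_finalPrize A hw) (integrable_const _)
      (hmain.mono fun y hy => hw.profit_mono hy)
  simpa using this

/-- The agent can be made to search so that he either opens a given box, or ends up with a wage
above its index. -/
theorem exists_weighted_le_principalPayoff (hw : w.DoublyMonotone) (i : Fin n) {m : ℝ}
    (hm : ∀ x, inducedIndex w (A i) < (w.wage x : EReal) → m ≤ w.profit x) :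
    ∃ q : ℝ, 0 ≤ q ∧ q ≤ 1 ∧
      ((q * ∫ z, w.profit z ∂(A i).law + (1 - q) * m : ℝ) : EReal) ≤ principalPayoff w A := by
  obtain ⟨σ, hσ, heager⟩ := exists_optimal_eager A hw
  obtain ⟨hint, heq⟩ := σ.integral_ite_mem_finalOpened w i (hw.integrable_profit (A i)) m
  refine ⟨(prizeLaw A).real {y | i ∈ σ.finalOpened w y}, measureReal_nonneg,
    measureReal_le_one, ?_⟩
  refine le_trans (EReal.coe_le_coe_iff.2 ?_)
    (le_iSup₂_of_le σ ((mem_optimalStrategies_iff A hw σ).2 hσ) le_rfl)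
  rw [← heq]
  refine integral_mono hint (σ.integrable_profit_finalPrize A hw) fun y => ?_
  change ite _ _ _ ≤ w.profit (σ.finalPrize w y)
  split_ifs with hi
  · exact hw.profit_mono (le_presentedPrize hw (mem_availablePrizes.2 (Or.inr ⟨i, hi, rfl⟩)))
  -- With a final wage at or below the index, opening box `i` and then stopping would at least break
  -- even, so the eager strategy could not have stopped. Eagerness matters when it exactly breaks
  -- even.
  · refine hm _ (not_le.1 fun hle => ?_)
    rw [Strategy.finalPrize, presentedPrize_mem.2] at hle
    have hnone := (σ.stopped_or_finalOpened_eq_univ w y).resolve_right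
      fun h => hi (h ▸ Finset.mem_univ i)
    refine (heager _ _ hnone i hi).not_ge ?_
    have hcost := cost_le_of_le_inducedIndex hw (A i) hle
    have hmax := integral_max_wage hw (A i) (bestWage w y (σ.finalOpened w y))
    have : ∫ z, max (bestWage w y (σ.finalOpened w y)) (w.wage z) ∂(A i).law ≤
        ∫ z, searchValue w A (insert i (σ.finalOpened w y))
          (max (bestWage w y (σ.finalOpened w y)) (w.wage z)) ∂(A i).law :=
      integral_mono ((integrable_const _).sup (hw.integrable_wage (A i)))
        (integrable_searchValue_max A hw _ _ _) fun z => le_searchValue A _ _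
    rw [openValue]
    linarith

end Payoffs

end DelegatedSearch

theorem mainTheorem9 (a₀ : DelegatedSearch.Project) (w : DelegatedSearch.Contract)
    (hw : w.DoublyMonotone) :
    DelegatedSearch.principalPayoff w ![a₀] = DelegatedSearch.payoffGuarantee w a₀ ∨
    ∀ ε : ℝ, 0 < ε → ∃ x : ℝ≥0,
      DelegatedSearch.inducedIndex w a₀ < ((w.wage x : ℝ) : EReal) ∧
      DelegatedSearch.principalPayoff w ![a₀, DelegatedSearch.Project.safe x] <
        DelegatedSearch.payoffGuarantee w a₀ + (ε : EReal) := by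
  open DelegatedSearch in
  have hguar_le : payoffGuarantee w a₀ ≤ principalPayoff w ![a₀] :=
    iInf_le_of_le 0 (iInf_le_of_le ![a₀] (iInf_le _ rfl))
  have hsingle := principalPayoff_single_le hw a₀
  set E : ℝ := ∫ z, w.profit z ∂a₀.law with hE
  -- any lower bound on the profits above the index is a lower bound on the guarantee
  have hguar : ∀ m : ℝ, (∀ x, inducedIndex w a₀ < (w.wage x : EReal) → m ≤ w.profit x) →
      ((min E m : ℝ) : EReal) ≤ payoffGuarantee w a₀ := by
    intro m hm
    refine le_iInf fun n => le_iInf fun A => le_iInf fun hA => ?_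
    subst hA
    obtain ⟨q, hq0, hq1, hq⟩ := exists_weighted_le_principalPayoff hw (A := A) 0 hm
    refine le_trans (EReal.coe_le_coe_iff.2 ?_) hq
    nlinarith [mul_le_mul_of_nonneg_left (min_le_left E m) hq0,
      mul_le_mul_of_nonneg_left (min_le_right E m) (sub_nonneg.2 hq1)]
  rw [or_iff_not_imp_left]
  intro hne ε hε
  have hlt : payoffGuarantee w a₀ < (E : EReal) :=
    (lt_of_le_of_ne hguar_le (Ne.symm hne)).trans_le hsingle
  set P : Set ℝ := w.profit '' {x | inducedIndex w a₀ < (w.wage x : EReal)} with hP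
  -- If no prize is paid above the index, the condition on `m` is vacuous, and `m = E` contradicts
  -- `hlt`.
  have hPne : P.Nonempty := by
    by_contra h
    rw [Set.not_nonempty_iff_eq_empty, Set.image_eq_empty] at h
    have := hguar E fun x hx => (Set.eq_empty_iff_forall_notMem.1 h x hx).elim
    rw [min_self] at this
    exact this.not_gt hlt
  have hPbdd : BddBelow P := ⟨w.profit 0, by
    rintro _ ⟨x, -, rfl⟩
    exact hw.profit_mono zero_le⟩
  have hinf := hguar (sInf P) fun x hx => csInf_le hPbdd ⟨x, hx, rfl⟩
  -- The minimum cannot be `E`, since the guarantee is strictly below it.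
  have hinf' : ((sInf P : ℝ) : EReal) ≤ payoffGuarantee w a₀ := by
    rcases min_choice E (sInf P) with h | h
    · rw [h] at hinf
      exact absurd hlt hinf.not_gt
    · rwa [h] at hinf
  obtain ⟨_, ⟨x, hx, rfl⟩, hxlt⟩ := exists_lt_of_csInf_lt hPne (lt_add_of_pos_right (sInf P) hε)
  refine ⟨x, hx, (principalPayoff_safe_le hw a₀ hx).trans_lt ?_⟩
  refine lt_of_lt_of_le (EReal.coe_lt_coe_iff.2 hxlt) ?_
  rw [EReal.coe_add]
  exact add_le_add_left hinf' _
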